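/- Let $\mathbb{Q}\langle\langle x_1,x_2,\dots\rangle\rangle$ be the ring of formal power series in countably many noncommuting variables. For a set partition $\pi\vdash[n]$ let $m_\pi=\sum x_{i_1}x_{i_2}\cdots x_{i_n}$, summed over all tuples $(i_1,\dots,i_n)$ of positive integers such that $i_j=i_k$ if and only if $j$ and $k$ lie in the same block of $\pi$. Put $\mathrm{NCSym}^n=\operatorname{span}_{\mathbb Q}\{m_\pi:\pi\vdash[n]\}$ (so $\mathrm{NCSym}^0=\operatorname{span}\{1\}$) and $\mathrm{NCSym}=\bigoplus_{n\ge0}\mathrm{NCSym}^n$. Let $\lambda(\pi)=(\lambda_1\ge\lambda_2\ge\cdots\ge\lambda_\ell)$ be the integer partition of $n$ formed by the block sizes of $\pi$, and $\lambda(\pi)!=\prod_i\lambda_i!$. Let $h_\pi=\sum_{\sigma\vdash[n]}\lambda(\sigma\wedge\pi)!\,m_\sigma$, where $\wedge$ is the meet in the refinement order, and write $[k]$ also for the set partition of $[k]$ with a single block, with $h_{[0]}=1$. For an integer partition $\lambda=(\lambda_1\ge\cdots\ge\lambda_\ell)$ of $n$ let $$s_{[\lambda]}=\sum_{\varepsilon\in\mathfrak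 S_\ell}\operatorname{sgn}(\varepsilon)\,a_{1\varepsilon(1)}a_{2\varepsilon(2)}\cdots a_{\ell\varepsilon(\ell)},\qquad a_{ij}=\frac{1}{(\lambda_i-i+j)!}\,h_{[\lambda_i-i+j]},$$ where $a_{ij}=0$ if $\lambda_i-i+j<0$. A permutation $\delta\in\mathfrak S_n$ acts linearly on homogeneous series of degree $n$ by moving the letter in place $j$ to place $\delta(j)$, so that $\delta\circ m_\pi=m_{\delta\pi}$ and $\delta\circ h_\pi=h_{\delta\pi}$. Let $\delta_\pi\in\mathfrak S_n$ be the permutation whose one-line notation lists the blocks of $\pi$ in weakly decreasing order of size, blocks of equal size by increasing least element, and the elements of each block in increasing order. The standard Schur function in noncommuting variables is $s_\pi=\delta_\pi\circ s_{[\lambda(\pi)]}$. Theorem 4.3. For every $n\ge1$ the family $(s_\pi)_{\pi\vdash[n]}$ is a basis of the $\mathbb Q$-vector space $\mathrm{NCSym}^n$. Hence $(s_\pi)_{\pi\vdash[n],\,n\ge1}$ is a basis of $\bigoplus_{n\ge1}\mathrm{NCSym}^n$ and, together with $1\in\mathrm{NCSym}^0$, it is a basis of $\mathrm{NCSym}$.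 Moreover, if $\rho:\mathbb{Q}\langle\langle x_1,x_2,\dots\rangle\rangle\to\mathbb{Q}[[x_1,x_2,\dots]]$ is the projection that lets the variables commute, then for every $n\ge 1$ and $\pi\vdash[n]$ $$\rho(s_\pi)=s_{\lambda(\pi)},$$ where $s_\lambda=\det\left(h_{\lambda_i-i+j}\right)_{1\le i,j\le\ell(\lambda)}$ is the classical Schur function, with $h_k$ the sum of all monomials of degree $k$ and $h_k=0$ for $k<0$. -/

import Mathlib

/-! ### The ring `ℚ⟨⟨x₀, x₁, …⟩⟩` of formal power series in noncommuting variables -/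

/-- Formal power series over `ℚ` in countably many noncommuting variables. The monomial
`x_{a₁} x_{a₂} ⋯ x_{aₙ}` is the word `[a₁, …, aₙ] : List ℕ`, and a series is the function that
sends each word to its coefficient. -/
def NCSeries : Type := List ℕ → ℚ

namespace NCSeries

noncomputable instance : AddCommGroup NCSeries := inferInstanceAs (AddCommGroup (List ℕ → ℚ))

noncomputable instance : Module ℚ NCSeries := inferInstanceAs (Module ℚ (List ℕ → ℚ))

/-- The unit series `1`: coefficient `1` at the empty word. -/
instance : One NCSeries := ⟨fun w => if w = [] then 1 else 0⟩

/-- Multiplication: concatenation of words, extended bilinearly. The coefficient of `w` in `f * g`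
is the sum of `f u * g v` over all factorisations `w = u ++ v`. -/
instance : Mul NCSeries :=
  ⟨fun f g w => ∑ i ∈ Finset.range (w.length + 1), f (w.take i) * g (w.drop i)⟩

theorem add_apply (f g : NCSeries) (w : List ℕ) : (f + g) w = f w + g w := rfl

theorem zero_apply (w : List ℕ) : (0 : NCSeries) w = 0 := rfl

theorem smul_apply (c : ℚ) (f : NCSeries) (w : List ℕ) : (c • f) w = c * f w := rfl

theorem one_apply (w : List ℕ) : (1 : NCSeries) w = if w = [] then 1 else 0 := rfl

theorem mul_apply (f g : NCSeries) (w : List ℕ) :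
    (f * g) w = ∑ i ∈ Finset.range (w.length + 1), f (w.take i) * g (w.drop i) := rfl

protected theorem mul_assoc (f g h : NCSeries) : f * g * h = f * (g * h) := by
  funext w
  simp only [mul_apply, Finset.sum_mul, Finset.mul_sum]
  rw [Finset.sum_sigma', Finset.sum_sigma']
  refine Finset.sum_bij' (fun p _ => ⟨p.2, p.1 - p.2⟩) (fun p _ => ⟨p.1 + p.2, p.1⟩) ?_ ?_ ?_ ?_ ?_
  · rintro ⟨i, j⟩ hp
    simp only [Finset.mem_sigma, Finset.mem_range, List.length_take, List.length_drop] at hp ⊢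
    omega
  · rintro ⟨i, j⟩ hp
    simp only [Finset.mem_sigma, Finset.mem_range, List.length_take, List.length_drop] at hp ⊢
    omega
  · rintro ⟨i, j⟩ hp
    simp only [Finset.mem_sigma, Finset.mem_range, List.length_take] at hp
    have : j + (i - j) = i := by omega
    simp [this]
  · rintro ⟨i, j⟩ hp
    simp
  · rintro ⟨i, j⟩ hp
    simp only [Finset.mem_sigma, Finset.mem_range, List.length_take] at hp
    have h1 : min j i = j := by omega
    have h2 : j + (i - j) = i := by omega
    simp only [List.take_take, List.drop_drop, List.drop_take, h1, h2]
    ring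

noncomputable instance : Ring NCSeries :=
  { (inferInstance : AddCommGroup NCSeries) with
    mul := (· * ·)
    one := 1
    mul_assoc := NCSeries.mul_assoc
    one_mul := fun f => by
      funext w
      rw [mul_apply, Finset.sum_eq_single 0]
      · simp [one_apply]
      · intro i hi h0
        have : w.take i ≠ [] := by
          intro h
          rw [List.take_eq_nil_iff] at h
          rcases h with h | h
          · exact h0 h
          · subst h; simp at hi; omega
        simp [one_apply, this]
      · simp
    mul_one := fun f => by
      funext w
      rw [mul_apply, Finset.sum_eq_single w.length]
      · simp [one_apply]
      · intro i hi h0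
        have : ¬ w.length ≤ i := by simp at hi; omega
        simp [one_apply, this]
      · simp
    zero_mul := fun f => by
      funext w; simp [mul_apply, zero_apply]
    mul_zero := fun f => by
      funext w; simp [mul_apply, zero_apply]
    left_distrib := fun f g h => by
      funext w; simp [mul_apply, add_apply, mul_add, Finset.sum_add_distrib]
    right_distrib := fun f g h => by
      funext w; simp [mul_apply, add_apply, add_mul, Finset.sum_add_distrib] }

/-- The projection `ρ : ℚ⟨⟨x₀, x₁, …⟩⟩ → ℚ⟦x₀, x₁, …⟧` that lets the variables commute. The
coefficient of `x^d` in `ρ f` is the sum of the coefficients in `f` of the (finitely many) words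
whose multiset of letters is `d`. -/
noncomputable def rho : NCSeries →ₗ[ℚ] MvPowerSeries ℕ ℚ where
  toFun f := fun d => ∑ w ∈ (Finsupp.toMultiset d).toList.permutations.toFinset, f w
  map_add' f g := by
    funext d
    exact Finset.sum_add_distrib
  map_smul' c f := by
    funext d
    exact (Finset.mul_sum _ _ _).symm

/-- The action of a permutation `δ` of the `n` places on series, `f ↦ δ ∘ f`. On a word of length
`n` it moves the letter at place `j` to place `δ j`, so that the coefficient of `a₀ ⋯ aₙ₋₁` in
`δ ∘ f` is the coefficient in `f` of the word with letter `a_{δ j}` at place `j`. The action only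
concerns homogeneous series of degree `n`; the other homogeneous components are left unchanged. -/
noncomputable def placeAct {n : ℕ} (δ : Equiv.Perm (Fin n)) : NCSeries →ₗ[ℚ] NCSeries where
  toFun f := fun w =>
    if h : w.length = n then f (List.ofFn fun j : Fin n => w.get ((δ j).cast h.symm)) else f w
  map_add' f g := by
    funext w
    change (if h : w.length = n then (f + g) _ else (f + g) w) =
      (if h : w.length = n then f _ else f w) + (if h : w.length = n then g _ else g w)
    by_cases h : w.length = n
    · simp only [dif_pos h, add_apply]
    · simp only [dif_neg h, add_apply]
  map_smul' c f := by
    funext w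
    change (if h : w.length = n then (c • f) _ else (c • f) w) =
      c * (if h : w.length = n then f _ else f w)
    by_cases h : w.length = n
    · simp only [dif_pos h, smul_apply]
    · simp only [dif_neg h, smul_apply]

/-- The noncommutative analogue of Leibniz' determinantal formula: the entries are multiplied from
the top row to the bottom row. -/
noncomputable def ncdet {R : Type*} [Ring R] {ℓ : ℕ} (A : Matrix (Fin ℓ) (Fin ℓ) R) : R :=
  ∑ ε : Equiv.Perm (Fin ℓ),
    (Equiv.Perm.sign ε : ℤ) • (List.ofFn fun i : Fin ℓ => A i (ε i)).prod

end NCSeries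

/-! ### Set partitions -/

/-- Set partitions of `[n]`, modelled as `Fin n = {0, …, n-1}`, with the refinement order. -/
abbrev SetPartition (n : ℕ) : Type := Finpartition (Finset.univ : Finset (Fin n))

namespace SetPartition

/-- `λ(π)`: the integer partition of `n` whose parts are the block sizes of `π`. -/
def shape {n : ℕ} (π : SetPartition n) : n.Partition where
  parts := π.parts.val.map Finset.card
  parts_pos := by
    intro i hi
    obtain ⟨B, hB, rfl⟩ := Multiset.mem_map.1 hi
    exact Finset.card_pos.2 (π.nonempty_of_mem_parts hB)
  parts_sum := by
    have h := π.sum_card_parts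
    simpa using h

/-- `λ(π)! = ∏ |B|!` over the blocks `B` of `π`. -/
def shapeFactorial {n : ℕ} (π : SetPartition n) : ℕ := ∏ B ∈ π.parts, B.card.factorial

/-- The least element of the block of `π` that contains `i`. -/
def blockMin {n : ℕ} (π : SetPartition n) (i : Fin n) : Fin n :=
  (π.part i).min' ⟨i, π.mem_part (Finset.mem_univ i)⟩

/-- The permutation `δ_π`. In one-line notation it lists the blocks of `π` one after the other, in
weakly decreasing order of size, blocks of equal size by increasing least element, and each block
in increasing order (the row reading of the tableau with these rows). So it is the permutation
that sorts `Fin n` by block size (decreasing), then by least element of the block, then by value: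
`Tuple.sort f` is the permutation `σ`, `j ↦` the `j`-th element in this order, for which `f ∘ σ`
is monotone and ties are kept in increasing order. -/
def readingPerm {n : ℕ} (π : SetPartition n) : Equiv.Perm (Fin n) :=
  Tuple.sort fun i : Fin n =>
    (toLex (OrderDual.toDual (π.part i).card, π.blockMin i) : ℕᵒᵈ ×ₗ Fin n)

end SetPartition

/-! ### Symmetric functions in noncommuting variables -/

namespace NCSeries

open Classical in
/-- The monomial symmetric function `m_π`: the sum of the words `x_{i₁} ⋯ x_{iₙ}` over all tuples
with `i_j = i_k` if and only if `j` and `k` are in the same block of `π`. -/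
noncomputable def mono {n : ℕ} (π : SetPartition n) : NCSeries := fun w =>
  if ∃ i : Fin n → ℕ, w = List.ofFn i ∧ ∀ j k, i j = i k ↔ π.part j = π.part k then 1 else 0

/-- The place action sends `m_π` to `m_{δπ}`, where `δπ` is the image of `π` under `δ`. -/
theorem placeAct_mono {n : ℕ} (δ : Equiv.Perm (Fin n)) (π σ : SetPartition n)
    (h : ∀ j k, σ.part (δ j) = σ.part (δ k) ↔ π.part j = π.part k) :
    placeAct δ (mono π) = mono σ := by
  classical
  funext w
  show (if hw : w.length = n then
    mono π (List.ofFn fun j : Fin n => w.get ((δ j).cast hw.symm)) else mono π w) = mono σ w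
  by_cases hw : w.length = n
  · subst hw
    simp only [dif_pos rfl, mono]
    congr 1
    apply propext
    constructor
    · rintro ⟨i, hi, hik⟩
      refine ⟨w.get, (List.ofFn_get w).symm, fun j k => ?_⟩
      have hi' := List.ofFn_injective hi
      have := hik (δ.symm j) (δ.symm k)
      rw [← h, ← hi'] at this
      simpa using this
    · rintro ⟨i, hi, hik⟩
      have hi' : w.get = i := List.ofFn_injective (by rw [← hi, List.ofFn_get])
      exact ⟨_, rfl, fun j k => by rw [← h, ← hik, ← hi']; rfl⟩
  · have key : ∀ τ : SetPartition n, mono τ w = 0 := by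
      intro τ
      apply if_neg
      rintro ⟨i, rfl, -⟩
      exact hw (by simp)
    rw [dif_neg hw, key, key]

/-- The complete homogeneous symmetric function `h_π = ∑_σ λ(σ ∧ π)! m_σ`. -/
noncomputable def homog {n : ℕ} (π : SetPartition n) : NCSeries :=
  ∑ σ : SetPartition n, ((σ ⊓ π).shapeFactorial : ℚ) • mono σ

/-- `(1 / k!) h_{[k]}` for an integer `k`, with `[k]` the set partition with one block (and
`[0] = ∅`); it is `0` for negative `k`. -/
noncomputable def scaledHomog : ℤ → NCSeries
  | Int.ofNat k => ((k.factorial : ℚ)⁻¹) • homog (⊤ : SetPartition k)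
  | Int.negSucc _ => 0

/-- The source Schur function `s_{[λ]}`: the noncommutative Jacobi-Trudi determinant of
`(1 / (λ_i - i + j)!) h_{[λ_i - i + j]}`, where `λ₁ ≥ λ₂ ≥ ⋯` are the parts of `λ`. -/
noncomputable def sourceSchur {n : ℕ} (lam : n.Partition) : NCSeries :=
  ncdet (Matrix.of fun i j : Fin (lam.parts.sort (· ≥ ·)).length =>
    scaledHomog (((lam.parts.sort (· ≥ ·)).get i : ℤ) - (i : ℤ) + (j : ℤ)))

/-- The standard Schur function in noncommuting variables, `s_π = δ_π ∘ s_{[λ(π)]}`. -/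
noncomputable def schur {n : ℕ} (π : SetPartition n) : NCSeries :=
  placeAct π.readingPerm (sourceSchur π.shape)

end NCSeries

/-- `NCSym^n`, the homogeneous component of degree `n`: the span of the `m_π` with `π ⊢ [n]`. -/
noncomputable def NCSymDeg (n : ℕ) : Submodule ℚ NCSeries :=
  Submodule.span ℚ (Set.range fun π : SetPartition n => NCSeries.mono π)

/-- `NCSym = NCSym^0 ⊕ NCSym^1 ⊕ ⋯` inside `ℚ⟨⟨x₀, x₁, …⟩⟩`. -/
noncomputable def NCSym : Submodule ℚ NCSeries := ⨆ n : ℕ, NCSymDeg n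

/-- `NCSym^1 ⊕ NCSym^2 ⊕ ⋯`. -/
noncomputable def NCSymPos : Submodule ℚ NCSeries := ⨆ n : ℕ+, NCSymDeg n

/-! ### Classical Schur functions -/

namespace SymFun

/-- The complete homogeneous symmetric function `h_k` in `ℚ⟦x₀, x₁, …⟧` for an integer `k`: the sum
of all monomials of degree `k`, and `0` for negative `k`. -/
noncomputable def homog (k : ℤ) : MvPowerSeries ℕ ℚ := fun d =>
  if (d.degree : ℤ) = k then 1 else 0

/-- The Schur function `s_λ = det (h_{λ_i - i + j})`. -/
noncomputable def schur {n : ℕ} (lam : n.Partition) : MvPowerSeries ℕ ℚ :=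
  Matrix.det (Matrix.of fun i j : Fin (lam.parts.sort (· ≥ ·)).length =>
    homog (((lam.parts.sort (· ≥ ·)).get i : ℤ) - (i : ℤ) + (j : ℤ)))

end SymFun

/-!
Write `Y_π` for the group of place permutations that preserve every block of `π` (a Young subgroup).
The number `λ(σ ∧ π)!` is the order of `Y_σ ∩ Y_π`. Consequently the coefficient of `h_π` at a word
`w` counts the permutations in `Y_π` that fix `w`; in this form (`labelSeries`,
`homog_eq_labelSeries`) it is plain that `δ ∘ h_π = h_{δπ}` and that a product of series `h_{[a]}` is
the `h` of the concatenated blocks (`prod_scaledHomog`).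

*Basis.* The matrix `(λ(σ ∧ π)!)` is the Gram matrix of the indicator functions of the groups `Y_π`
in `ℚ^{S_n}`. These are linearly independent, because a permutation that cycles each block of `τ`
lies in `Y_π` exactly when `τ ≤ π`; hence the `h_π` form a basis of `NCSym^n`
(`linearIndependent_homog`, `span_homog`). The determinant for `s_π` expands into multiples of `h_τ`,
where `τ` has block sizes `λ_i - i + ε(i)`. The identity contributes a nonzero multiple of `h_π`
itself, since `δ_π` carries consecutive intervals of lengths `λ_i` to the blocks of `π`
(`exists_blockLabels_shape`). For every other `ε`, the rearrangement inequality gives `τ` a strictly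
larger sum of squares of block sizes (`sum_sq_lt_of_strictAnti`). So the `s_π` are triangular in the
`h_π` (`schur_sub_mem_span`). Bases in different degrees fit together because the series are
supported on words of different lengths.

*Projection.* `ρ` is a ring homomorphism that forgets the order of the places, and the
orbit-stabilizer count `sum_symCount_words` gives `ρ (h_{[k]} / k!) = h_k`. It therefore maps the
noncommutative determinant to the commutative one.
-/

open Equiv

/-! ### Permutations preserving a word -/

/-- The product of the factorials of the multiplicities of the letters of `l`; by `symCount_ofFn` it
is the number of permutations of the places that preserve `l`. -/
def symCount {α : Type*} [DecidableEq α] (l : List α) : ℕ :=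
  ∏ a ∈ l.toFinset, (l.count a).factorial

section symCount

variable {α β : Type*} [DecidableEq α] [DecidableEq β]

theorem count_ofFn {n : ℕ} (f : Fin n → α) (a : α) :
    (List.ofFn f).count a = (Finset.univ.filter fun i => f i = a).card := by
  rw [List.ofFn_eq_map, ← Multiset.coe_count, ← Multiset.map_coe, Multiset.count_map]
  have : ((List.finRange n : List (Fin n)) : Multiset (Fin n)) = Finset.univ.val := rfl
  rw [this, Finset.card_def, Finset.filter_val]
  simp only [eq_comm]

theorem toFinset_ofFn {n : ℕ} (f : Fin n → α) :
    (List.ofFn f).toFinset = Finset.univ.image f := by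
  ext a; simp [List.mem_ofFn]

theorem symCount_ofFn {n : ℕ} (f : Fin n → α) :
    symCount (List.ofFn f) = Fintype.card {g : Perm (Fin n) // f ∘ g = f} := by
  rw [DomMulAct.stabilizer_card', symCount, toFinset_ofFn]
  refine Finset.prod_congr rfl fun a _ => ?_
  rw [count_ofFn, Fintype.card_subtype]

/-- `symCount` only depends on which places carry equal letters. -/
theorem symCount_ofFn_congr {n : ℕ} {f : Fin n → α} {g : Fin n → β}
    (h : ∀ i j, f i = f j ↔ g i = g j) : symCount (List.ofFn f) = symCount (List.ofFn g) := by
  rw [symCount_ofFn, symCount_ofFn]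
  refine Fintype.card_congr (Equiv.subtypeEquivRight fun e => ?_)
  simp only [funext_iff, Function.comp_apply, h]

theorem symCount_perm {l l' : List α} (h : l.Perm l') : symCount l = symCount l' := by
  unfold symCount
  rw [List.toFinset_eq_of_perm _ _ h]
  exact Finset.prod_congr rfl fun a _ => by rw [h.count_eq]

theorem symCount_map {φ : α → β} (hφ : Function.Injective φ) (l : List α) :
    symCount (l.map φ) = symCount l := by
  have h : l = List.ofFn l.get := (List.ofFn_get l).symm
  rw [h, List.map_ofFn]
  exact symCount_ofFn_congr fun i j => hφ.eq_iff

theorem symCount_append {l l' : List α} (h : l.Disjoint l') :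
    symCount (l ++ l') = symCount l * symCount l' := by
  unfold symCount
  rw [List.toFinset_append, Finset.prod_union (List.disjoint_toFinset_iff_disjoint.2 h)]
  congr 1 <;> refine Finset.prod_congr rfl fun a ha => ?_
  · rw [List.count_append, List.count_eq_zero_of_not_mem (h (List.mem_toFinset.1 ha)), add_zero]
  · rw [List.count_append,
      List.count_eq_zero_of_not_mem fun h' => h h' (List.mem_toFinset.1 ha), zero_add]

theorem symCount_nil : symCount ([] : List α) = 1 := by simp [symCount]

end symCount

/-! ### Set partitions as kernels of labellings -/

namespace SetPartition

theorem part_inf_eq_iff {n : ℕ} (σ π : SetPartition n) (i j : Fin n) :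
    (σ ⊓ π).part i = (σ ⊓ π).part j ↔ σ.part i = σ.part j ∧ π.part i = π.part j := by
  have key : ∀ τ : SetPartition n, τ.part i = τ.part j ↔ i ∈ τ.part j := fun τ =>
    (τ.mem_part_iff_part_eq_part (Finset.mem_univ i) (Finset.mem_univ j)).symm
  simp only [key]
  have hs : (σ ⊓ π).part j = σ.part j ∩ π.part j := by
    apply Finpartition.part_eq_of_mem
    · rw [Finpartition.parts_inf, Finset.mem_erase]
      refine ⟨?_, Finset.mem_image.2 ⟨(σ.part j, π.part j), ?_, rfl⟩⟩
      · exact Finset.Nonempty.ne_empty ⟨j, by simp⟩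
      · simp
    · simp
  rw [hs, Finset.mem_inter]

theorem shapeFactorial_eq {n : ℕ} (π : SetPartition n) :
    π.shapeFactorial = symCount (List.ofFn π.part) := by
  unfold shapeFactorial symCount
  have : (List.ofFn π.part).toFinset = π.parts := by
    rw [toFinset_ofFn]
    ext B
    simp only [Finset.mem_image, Finset.mem_univ, true_and]
    constructor
    · rintro ⟨i, rfl⟩; simp
    · intro hB
      obtain ⟨i, hi⟩ := π.nonempty_of_mem_parts hB
      exact ⟨i, π.part_eq_of_mem hB hi⟩
  rw [this]
  refine Finset.prod_congr rfl fun B hB => ?_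
  rw [count_ofFn]
  congr 2
  ext i
  simp [π.part_eq_iff_mem hB]

/-- The set partition of `[n]` into the nonempty fibres of a function. -/
def ker {α : Type*} [DecidableEq α] {n : ℕ} (f : Fin n → α) : SetPartition n :=
  letI : DecidableRel (Setoid.ker f) := fun i j => decEq (f i) (f j)
  Finpartition.ofSetoid (Setoid.ker f)

theorem ker_part_eq_iff {α : Type*} [DecidableEq α] {n : ℕ} (f : Fin n → α) (i j : Fin n) :
    (ker f).part i = (ker f).part j ↔ f i = f j := by
  let _ : DecidableRel (Setoid.ker f) := fun i j => decEq (f i) (f j)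
  rw [← Finpartition.mem_part_iff_part_eq_part _ (Finset.mem_univ i) (Finset.mem_univ j)]
  refine Finpartition.mem_part_ofSetoid_iff_rel.trans ?_
  rw [Setoid.ker_def, eq_comm]

theorem ext_part {n : ℕ} {π σ : SetPartition n}
    (h : ∀ i j, π.part i = π.part j ↔ σ.part i = σ.part j) : π = σ := by
  have hp : ∀ i, π.part i = σ.part i := by
    intro i
    ext j
    rw [π.mem_part_iff_part_eq_part (Finset.mem_univ j) (Finset.mem_univ i), h,
      σ.mem_part_iff_part_eq_part (Finset.mem_univ j) (Finset.mem_univ i)]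
  have sub : ∀ π σ : SetPartition n, (∀ i, π.part i = σ.part i) → π.parts ⊆ σ.parts := by
    intro π σ hp B hB
    obtain ⟨i, hi⟩ := π.nonempty_of_mem_parts hB
    rw [← π.part_eq_of_mem hB hi, hp]
    simp
  exact Finpartition.ext (Finset.Subset.antisymm (sub π σ hp) (sub σ π fun i => (hp i).symm))

end SetPartition

/-! ### The series `h_π` as counts of permutations -/

namespace NCSeries

open SetPartition

theorem mono_ofFn {n : ℕ} (π : SetPartition n) (u : Fin n → ℕ) :
    mono π (List.ofFn u) = if ker u = π then 1 else 0 := by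
  unfold mono
  congr 1
  apply propext
  constructor
  · rintro ⟨i, hi, hik⟩
    obtain rfl := List.ofFn_injective hi
    exact ext_part fun j k => (ker_part_eq_iff _ _ _).trans (hik j k)
  · rintro rfl
    exact ⟨u, rfl, fun j k => (ker_part_eq_iff _ _ _).symm⟩

theorem mono_of_length_ne {n : ℕ} (π : SetPartition n) {w : List ℕ} (hw : w.length ≠ n) :
    mono π w = 0 := by
  apply if_neg
  rintro ⟨i, rfl, -⟩
  exact hw (by simp)

theorem sum_apply {ι : Type*} (s : Finset ι) (f : ι → NCSeries) (w : List ℕ) :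
    (∑ i ∈ s, f i) w = ∑ i ∈ s, f i w :=
  Finset.sum_apply w s f

theorem exists_ofFn {α : Type*} {n : ℕ} {w : List α} (hw : w.length = n) :
    ∃ u : Fin n → α, w = List.ofFn u := by
  subst hw
  exact ⟨w.get, (List.ofFn_get w).symm⟩

theorem zip_ofFn {α β : Type*} {n : ℕ} (f : Fin n → α) (g : Fin n → β) :
    (List.ofFn f).zip (List.ofFn g) = List.ofFn fun i => (f i, g i) := by
  apply List.ext_getElem <;> simp

/-- The series attached to a word `l` of labels on the places: the coefficient of a word `w` of the
same length is the number of permutations of the places that preserve both `l` and `w`. It only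
depends on the set partition of the places into those with equal labels. -/
def labelSeries {α : Type*} [DecidableEq α] (l : List α) : NCSeries := fun w =>
  if w.length = l.length then (symCount (l.zip w) : ℚ) else 0

theorem labelSeries_ofFn {α : Type*} [DecidableEq α] {n : ℕ} (f : Fin n → α) (u : Fin n → ℕ) :
    labelSeries (List.ofFn f) (List.ofFn u) = symCount (List.ofFn fun i => (f i, u i)) := by
  simp [labelSeries, zip_ofFn]

theorem homog_eq_labelSeries {α : Type*} [DecidableEq α] {n : ℕ} (π : SetPartition n)
    (f : Fin n → α) (h : ∀ i j, f i = f j ↔ π.part i = π.part j) :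
    homog π = labelSeries (List.ofFn f) := by
  funext w
  by_cases hw : w.length = n
  · obtain ⟨u, rfl⟩ := exists_ofFn hw
    rw [labelSeries_ofFn, homog, sum_apply]
    simp only [smul_apply, mono_ofFn]
    rw [Finset.sum_eq_single (ker u)]
    · rw [if_pos rfl, mul_one, shapeFactorial_eq]
      congr 1
      apply symCount_ofFn_congr
      intro i j
      rw [part_inf_eq_iff, ker_part_eq_iff, Prod.mk.injEq, h, and_comm]
    · intro σ _ hσ
      rw [if_neg (Ne.symm hσ), mul_zero]
    · simp
  · rw [homog, sum_apply]
    simp [smul_apply, mono_of_length_ne _ hw, labelSeries, hw]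

theorem placeAct_ofFn {n : ℕ} (δ : Perm (Fin n)) (f : NCSeries) (u : Fin n → ℕ) :
    placeAct δ f (List.ofFn u) = f (List.ofFn (u ∘ δ)) := by
  show (if h : (List.ofFn u).length = n then
    f (List.ofFn fun j : Fin n => (List.ofFn u).get ((δ j).cast h.symm)) else _) = _
  rw [dif_pos (by simp)]
  congr 2
  funext j
  simp

theorem placeAct_of_length_ne {n : ℕ} (δ : Perm (Fin n)) (f : NCSeries) {w : List ℕ}
    (hw : w.length ≠ n) : placeAct δ f w = f w :=
  dif_neg hw

theorem placeAct_labelSeries {α : Type*} [DecidableEq α] {n : ℕ} (δ : Perm (Fin n))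
    (f : Fin n → α) :
    placeAct δ (labelSeries (List.ofFn f)) = labelSeries (List.ofFn (f ∘ δ.symm)) := by
  funext w
  by_cases hw : w.length = n
  · obtain ⟨u, rfl⟩ := exists_ofFn hw
    rw [placeAct_ofFn, labelSeries_ofFn, labelSeries_ofFn]
    congr 1
    apply symCount_perm
    have := Equiv.Perm.ofFn_comp_perm δ (fun i => ((f ∘ δ.symm) i, u i))
    convert this using 2
    funext i
    simp
  · rw [placeAct_of_length_ne _ _ hw]
    simp [labelSeries, hw]

theorem scaledHomog_natCast_apply (k : ℕ) (w : List ℕ) :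
    scaledHomog k w = if w.length = k then (k.factorial : ℚ)⁻¹ * symCount w else 0 := by
  show ((k.factorial : ℚ)⁻¹ • homog (⊤ : SetPartition k)) w = _
  have htop : homog (⊤ : SetPartition k) = labelSeries (List.ofFn fun _ : Fin k => ()) := by
    apply homog_eq_labelSeries
    intro i j
    have hp : ∀ i, (⊤ : SetPartition k).part i = Finset.univ := by
      intro i
      have h1 := (⊤ : SetPartition k).part_mem.2 (Finset.mem_univ i)
      have h2 := Finpartition.parts_top_subset (Finset.univ : Finset (Fin k)) h1
      simpa using h2
    simp [hp]
  rw [htop, smul_apply]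
  by_cases hw : w.length = k
  · obtain ⟨u, rfl⟩ := exists_ofFn hw
    rw [labelSeries_ofFn, if_pos hw]
    congr 2
    exact symCount_ofFn_congr fun i j => by simp
  · simp [labelSeries, hw]

/-- The word of labels `0^{a₀} 1^{a₁} 2^{a₂} ⋯`, whose places of equal label are consecutive intervals
of lengths `a₀, a₁, a₂, …`. -/
def blockLabels : List ℕ → List ℕ
  | [] => []
  | a :: L => List.replicate a 0 ++ (blockLabels L).map Nat.succ

theorem length_blockLabels (L : List ℕ) : (blockLabels L).length = L.sum := by
  induction L with
  | nil => rfl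
  | cons a L ih => simp [blockLabels, ih]

/-- A product of one-block series `h_{[a]}` is the series of the concatenated blocks. -/
theorem prod_scaledHomog (L : List ℕ) :
    (L.map fun k : ℕ => scaledHomog k).prod =
      ((L.map fun k : ℕ => (k.factorial : ℚ)⁻¹).prod) • labelSeries (blockLabels L) := by
  induction L with
  | nil =>
    funext w
    cases w <;> simp [one_apply, smul_apply, labelSeries, blockLabels, symCount_nil]
  | cons a L ih =>
    funext w
    rw [List.map_cons, List.prod_cons, ih, mul_apply, smul_apply]
    by_cases ha : a ≤ w.length
    · -- Only the cut after `a` letters contributes, as `h_{[a]}` is homogeneous of degree `a`.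
      rw [Finset.sum_eq_single a]
      · rw [scaledHomog_natCast_apply, if_pos (by simpa using ha), smul_apply]
        simp only [labelSeries, blockLabels, List.length_drop, length_blockLabels,
          List.length_append, List.length_replicate, List.length_map, List.map_cons,
          List.prod_cons]
        by_cases hL : w.length = a + L.sum
        · rw [if_pos (by omega), if_pos hL]
          -- The two halves of the labelled word share no letter, so `symCount` is multiplicative.
          have hz : ((List.replicate a 0 ++ (blockLabels L).map Nat.succ).zip w) =
              ((w.take a).map fun x => (0, x)) ++
                (((blockLabels L).zip (w.drop a)).map fun p => (p.1.succ, p.2)) := by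
            conv_lhs => rw [← List.take_append_drop a w]
            rw [List.zip_append (by simp [ha])]
            congr 1
            · apply List.ext_getElem <;> simp
            · rw [List.zip_map_left]; rfl
          rw [hz, symCount_append, symCount_map, symCount_map]
          · push_cast; ring
          · rintro ⟨x, y⟩ ⟨x', y'⟩ h
            simpa using h
          · intro x y h
            simpa using h
          · rintro ⟨x, y⟩ h1 h2
            simp only [List.mem_map, Prod.mk.injEq] at h1 h2
            obtain ⟨_, _, rfl, _⟩ := h1
            obtain ⟨_, _, h, _⟩ := h2
            exact Nat.succ_ne_zero _ h
        · rw [if_neg (by omega), if_neg hL]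
          simp
      · intro i hi hia
        rw [scaledHomog_natCast_apply, if_neg, zero_mul]
        simp at hi ⊢
        omega
      · intro h
        simp at h
        omega
    · rw [Finset.sum_eq_zero]
      · unfold labelSeries
        rw [if_neg (by rw [length_blockLabels, List.sum_cons]; omega), mul_zero]
      · intro i hi
        rw [scaledHomog_natCast_apply, if_neg, zero_mul]
        simp at hi ⊢
        omega

end NCSeries

/-! ### The reading permutation -/

/-- A tuple is a rearrangement of the word that lists each of its values as often as it occurs. -/
theorem perm_flatMap_replicate {α : Type*} [DecidableEq α] {n : ℕ} {f : Fin n → α} {vs : List α}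
    (hnd : vs.Nodup) (hmem : ∀ v, v ∈ vs ↔ ∃ i, f i = v) {s : α → ℕ}
    (hs : ∀ i, (Finset.univ.filter fun j => f j = f i).card = s (f i)) :
    (List.ofFn f).Perm (vs.flatMap fun v => List.replicate (s v) v) := by
  rw [List.perm_iff_count]
  intro v
  have hsum : (vs.map (List.count v ∘ fun w => List.replicate (s w) w)).sum =
      if v ∈ vs then s v else 0 := by
    rw [← List.sum_toFinset _ hnd]
    simp only [Function.comp_apply, List.count_replicate, beq_iff_eq]
    rw [Finset.sum_ite_eq' vs.toFinset v s]
    simp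
  rw [count_ofFn, List.count_flatMap, hsum]
  split_ifs with h
  · obtain ⟨i, rfl⟩ := (hmem v).1 h
    exact hs i
  · rw [Finset.card_eq_zero, Finset.filter_eq_empty_iff]
    exact fun i _ hi => h ((hmem v).2 ⟨i, hi⟩)

namespace NCSeries

open SetPartition

theorem mem_blockLabels_lt {L : List ℕ} {k : ℕ} (hk : k ∈ blockLabels L) : k < L.length := by
  induction L generalizing k with
  | nil => simp [blockLabels] at hk
  | cons a L ih =>
    simp only [blockLabels, List.mem_append, List.mem_replicate, List.mem_map] at hk
    rcases hk with ⟨_, rfl⟩ | ⟨j, hj, rfl⟩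
    · simp
    · simpa using ih hj

/-- Replacing the labels by the entries `v` of a list turns `blockLabels` into the word of
consecutive runs of the letters `v`, of lengths `s v`. -/
theorem map_blockLabels {α : Type*} (s : α → ℕ) (vs : List α) :
    (blockLabels (vs.map s)).map (fun k => vs[k]?) =
      (vs.flatMap fun v => List.replicate (s v) v).map some := by
  induction vs with
  | nil => rfl
  | cons v vs ih =>
    rw [List.map_cons, blockLabels, List.flatMap_cons, List.map_append, List.map_append, ← ih]
    simp [Function.comp_def]

theorem sum_count_blockLabels (L : List ℕ) :
    ((blockLabels L).map fun k => (blockLabels L).count k).sum = (L.map fun a => a * a).sum := by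
  induction L with
  | nil => rfl
  | cons a L ih =>
    have h0 : ((blockLabels L).map Nat.succ).count 0 = 0 :=
      List.count_eq_zero_of_not_mem (by simp)
    have hs : ∀ k, ((blockLabels L).map Nat.succ).count (k + 1) = (blockLabels L).count k :=
      fun k => List.count_map_of_injective _ _ Nat.succ_injective k
    have hr : ∀ k, (List.replicate a 0).count (k + 1) = 0 := fun k =>
      List.count_eq_zero_of_not_mem (by simp)
    rw [blockLabels, List.map_append, List.sum_append, List.map_map, List.map_cons, List.sum_cons,
      ← ih]
    congr 1
    · simp [List.count_append, h0]
    · simp [Function.comp_def, List.count_append, hs, hr]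

end NCSeries

namespace SetPartition

open NCSeries

/-- The key by which `readingPerm` sorts the elements of `[n]`. -/
def readingKey {n : ℕ} (π : SetPartition n) (i : Fin n) : ℕᵒᵈ ×ₗ Fin n :=
  toLex (OrderDual.toDual (π.part i).card, π.blockMin i)

/-- The size of the block that a sorting key describes. -/
def keySize {n : ℕ} (v : ℕᵒᵈ ×ₗ Fin n) : ℕ := OrderDual.ofDual (ofLex v).1

theorem readingKey_eq_iff {n : ℕ} (π : SetPartition n) (i j : Fin n) :
    π.readingKey i = π.readingKey j ↔ π.part i = π.part j := by
  constructor
  · intro h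
    have hmin : π.blockMin i = π.blockMin j := congrArg (fun v => (ofLex v).2) h
    have key : ∀ i, π.part (π.blockMin i) = π.part i := fun i =>
      π.part_eq_of_mem (by simp) (Finset.min'_mem _ _)
    rw [← key i, hmin, key]
  · intro h
    simp only [readingKey, blockMin, h]

/-- The keys that occur, one for each block, in increasing order. -/
def keyList {n : ℕ} (π : SetPartition n) : List (ℕᵒᵈ ×ₗ Fin n) :=
  (Finset.univ.image π.readingKey).sort (· ≤ ·)

/-- Along the reading permutation the keys form consecutive runs, one for each block and as long as
the block. -/
theorem ofFn_readingKey_readingPerm {n : ℕ} (π : SetPartition n) :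
    List.ofFn (π.readingKey ∘ π.readingPerm) =
      π.keyList.flatMap fun v => List.replicate (keySize v) v := by
  have hsort : π.keyList.Pairwise (· ≤ ·) := Finset.pairwise_sort _ _
  apply List.Perm.eq_of_pairwise' (r := (· ≤ ·))
  · have hm : Monotone (π.readingKey ∘ π.readingPerm) := Tuple.monotone_sort _
    rw [List.pairwise_ofFn]
    exact fun i j hij => hm hij.le
  · rw [List.pairwise_flatMap]
    refine ⟨fun v _ => by simp [List.pairwise_replicate], hsort.imp fun {v w} hvw => ?_⟩
    intro x hx y hy
    rw [List.eq_of_mem_replicate hx, List.eq_of_mem_replicate hy]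
    exact hvw
  · refine (Equiv.Perm.ofFn_comp_perm π.readingPerm π.readingKey).trans ?_
    refine perm_flatMap_replicate (Finset.sort_nodup _ _) (fun v => by simp) fun i => ?_
    show _ = (π.part i).card
    congr 1
    ext j
    simp only [Finset.mem_filter, Finset.mem_univ, true_and, readingKey_eq_iff]
    exact (π.mem_part_iff_part_eq_part (Finset.mem_univ j) (Finset.mem_univ i)).symm

theorem sort_shape_eq {n : ℕ} (π : SetPartition n) :
    π.shape.parts.sort (· ≥ ·) = π.keyList.map keySize := by
  apply List.Perm.eq_of_pairwise' (r := (· ≥ ·)) (Multiset.pairwise_sort _ _)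
  · rw [List.pairwise_map]
    have hsort : π.keyList.Pairwise (· ≤ ·) := Finset.pairwise_sort _ _
    refine hsort.imp fun {v w} hvw => ?_
    exact OrderDual.ofDual_le_ofDual.2 (Prod.Lex.monotone_fst _ _ hvw)
  · -- Both multisets of sizes are indexed by a set `r` of representatives of the blocks.
    rw [← Multiset.coe_eq_coe, Multiset.sort_eq, ← Multiset.map_coe, keyList, Finset.sort_eq]
    obtain ⟨r, -, hr⟩ := π.exists_subset_part_bijOn
    have hparts : r.image π.part = π.parts := by
      apply Finset.coe_injective
      rw [Finset.coe_image]
      exact hr.image_eq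
    have hkeys : Finset.univ.image π.readingKey = r.image π.readingKey := by
      refine Finset.Subset.antisymm (fun v hv => ?_) (Finset.image_subset_image (by simp))
      obtain ⟨i, -, rfl⟩ := Finset.mem_image.1 hv
      have hi : π.part i ∈ r.image π.part := by rw [hparts]; simp
      obtain ⟨j, hj, hij⟩ := Finset.mem_image.1 hi
      exact Finset.mem_image.2 ⟨j, hj, (π.readingKey_eq_iff _ _).2 hij⟩
    have hinj : Set.InjOn π.readingKey r := fun i hi j hj h =>
      hr.injOn hi hj ((π.readingKey_eq_iff _ _).1 h)
    rw [hkeys, Finset.image_val_of_injOn hinj, Multiset.map_map]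
    show π.parts.val.map Finset.card = _
    rw [← hparts, Finset.image_val_of_injOn hr.injOn, Multiset.map_map]
    rfl

/-- `δ_π` carries the consecutive intervals of lengths `λ₁, λ₂, …` to the blocks of `π`. -/
theorem exists_blockLabels_shape {n : ℕ} (π : SetPartition n) :
    ∃ f : Fin n → ℕ, blockLabels (π.shape.parts.sort (· ≥ ·)) = List.ofFn f ∧
      ∀ i j, f i = f j ↔ π.part (π.readingPerm i) = π.part (π.readingPerm j) := by
  have hlen : (blockLabels (π.shape.parts.sort (· ≥ ·))).length = n := by
    rw [length_blockLabels, ← Multiset.sum_coe, Multiset.sort_eq, π.shape.parts_sum]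
  obtain ⟨f, hf⟩ := exists_ofFn hlen
  refine ⟨f, hf, fun i j => ?_⟩
  have hnd : π.keyList.Nodup := Finset.sort_nodup _ _
  have hmap := map_blockLabels keySize π.keyList
  rw [← sort_shape_eq, ← ofFn_readingKey_readingPerm, hf, List.map_ofFn, List.map_ofFn] at hmap
  have hg := congrFun (List.ofFn_injective hmap)
  simp only [Function.comp_apply] at hg
  have hlt : ∀ i, f i < π.keyList.length := by
    intro i
    have : f i ∈ blockLabels (π.shape.parts.sort (· ≥ ·)) := by
      rw [hf]; exact List.mem_ofFn.2 ⟨i, rfl⟩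
    simpa [sort_shape_eq] using mem_blockLabels_lt this
  rw [← readingKey_eq_iff, ← Option.some_inj (a := π.readingKey _), ← hg, ← hg,
    List.getElem?_inj (hlt i) hnd]

/-! ### Triangularity -/

/-- The sum of the squares of the block sizes of `π`, written as the sum over all elements of the
size of their block. -/
def sqSum {n : ℕ} (π : SetPartition n) : ℕ := ∑ i, (π.part i).card

theorem sqSum_le {n : ℕ} (π : SetPartition n) : π.sqSum ≤ n * n := by
  refine (Finset.sum_le_card_nsmul _ _ n fun i _ => ?_).trans (by simp)
  simpa using Finset.card_le_univ (π.part i)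

/-- If `δ` carries consecutive intervals of lengths `L` to the blocks of `π`, then `sqSum π` is the
sum of the squares of the entries of `L`. -/
theorem sqSum_eq {n : ℕ} (π : SetPartition n) {L : List ℕ} {f : Fin n → ℕ}
    (hf : blockLabels L = List.ofFn f) (δ : Perm (Fin n))
    (h : ∀ i j, f i = f j ↔ π.part (δ i) = π.part (δ j)) :
    π.sqSum = (L.map fun a => a * a).sum := by
  rw [← sum_count_blockLabels, hf, List.map_ofFn, List.sum_ofFn, sqSum, ← Equiv.sum_comp δ]
  refine Finset.sum_congr rfl fun i _ => ?_
  rw [Function.comp_apply, count_ofFn]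
  refine (Finset.card_equiv δ fun j => ?_).symm
  rw [Finset.mem_filter, h,
    π.mem_part_iff_part_eq_part (Finset.mem_univ _) (Finset.mem_univ _)]
  simp

end SetPartition

/-- A form of the rearrangement inequality: for a strictly decreasing `b`, the sum of the squares
`(b_k + ε(k))²` is smallest exactly at `ε = 1`. -/
theorem sum_sq_lt_of_strictAnti {ℓ : ℕ} {b : Fin ℓ → ℤ} (hb : StrictAnti b) {ε : Perm (Fin ℓ)}
    (hε : ε ≠ 1) :
    ∑ k, (b k + (k : ℤ)) * (b k + (k : ℤ)) < ∑ k, (b k + (ε k : ℤ)) * (b k + (ε k : ℤ)) := by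
  have hanti : Antivary b (fun k : Fin ℓ => ((k : ℕ) : ℤ)) := by
    intro i j hij
    exact (hb (by simpa using hij : i < j)).le
  have hlt := (hanti.sum_mul_lt_sum_mul_comp_perm_iff (σ := ε)).2 (by
    intro h
    apply hε
    -- If `ε` too is arranged oppositely to `b`, then its inverse is increasing.
    have hmono : StrictMono ε.symm := by
      intro i j hij
      by_contra hc
      have hlt : ε.symm j < ε.symm i :=
        lt_of_le_of_ne (not_lt.1 hc) fun he => hij.ne' (ε.symm.injective he)
      have := h (i := ε.symm i) (j := ε.symm j) (by simpa using hij)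
      exact absurd (hb hlt) (not_lt.2 this)
    have hid : (ε.symm : Fin ℓ → Fin ℓ) = id := by
      apply StrictMono.range_inj hmono strictMono_id |>.1
      simp [ε.symm.surjective.range_eq]
    ext k
    have := congrFun hid (ε k)
    simp at this
    simp [← this])
  simp only [smul_eq_mul] at hlt
  have hsq : ∑ k, ((ε k : ℕ) : ℤ) * ((ε k : ℕ) : ℤ) = ∑ k : Fin ℓ, ((k : ℕ) : ℤ) * ((k : ℕ) : ℤ) :=
    Equiv.sum_comp ε fun k => ((k : ℕ) : ℤ) * ((k : ℕ) : ℤ)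
  have expand : ∀ x y : ℤ, (x + y) * (x + y) = x * x + 2 * (x * y) + y * y := fun x y => by ring
  simp only [expand, Finset.sum_add_distrib, ← Finset.mul_sum, hsq]
  linarith

namespace NCSeries

open SetPartition

/-- Away from the identity permutation, the terms of the Jacobi-Trudi expansion of `s_π` are
multiples of `h_τ` for set partitions `τ` with a larger sum of squares of block sizes. -/
theorem schur_sub_mem_span {n : ℕ} (π : SetPartition n) :
    ∃ c : ℚ, c ≠ 0 ∧ schur π - c • homog π ∈
      Submodule.span ℚ (homog '' {τ : SetPartition n | π.sqSum < τ.sqSum}) := by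
  obtain ⟨f, hf, hfπ⟩ := π.exists_blockLabels_shape
  have hsq := π.sqSum_eq hf _ hfπ
  have hsum : (π.shape.parts.sort (· ≥ ·)).sum = n := by
    rw [← Multiset.sum_coe, Multiset.sort_eq, π.shape.parts_sum]
  have hsorted : (π.shape.parts.sort (· ≥ ·)).Pairwise (· ≥ ·) := Multiset.pairwise_sort _ _
  unfold schur sourceSchur ncdet
  generalize π.shape.parts.sort (· ≥ ·) = L at hf hsq hsum hsorted
  refine ⟨(L.map fun k : ℕ => (k.factorial : ℚ)⁻¹).prod, ?_, ?_⟩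
  · rw [Ne, List.prod_eq_zero_iff]
    simp [Nat.factorial_ne_zero]
  simp only [map_sum, map_zsmul, Matrix.of_apply]
  rw [← Finset.add_sum_erase _ _ (Finset.mem_univ (1 : Perm (Fin L.length)))]
  -- The diagonal product is a multiple of `h_π`.
  have hone : (List.ofFn fun i : Fin L.length =>
      scaledHomog ((L.get i : ℤ) - (i : ℤ) + (((1 : Perm (Fin L.length)) i : Fin _) : ℤ))).prod =
      (L.map fun k : ℕ => (k.factorial : ℚ)⁻¹).prod • labelSeries (List.ofFn f) := by
    rw [← hf, ← prod_scaledHomog]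
    congr 1
    conv_rhs => rw [← List.ofFn_get L, List.map_ofFn]
    congr 1
    funext i
    simp
  rw [hone, Perm.sign_one, Units.val_one, one_smul, map_smul, placeAct_labelSeries,
    ← homog_eq_labelSeries π, add_sub_cancel_left]
  swap
  · intro i j
    simp [hfπ]
  refine Submodule.sum_mem _ fun ε hε => ?_
  rw [← Int.cast_smul_eq_zsmul ℚ]
  refine Submodule.smul_mem _ _ ?_
  -- A product with a negative index vanishes.
  by_cases hneg : ∃ i : Fin L.length, (L.get i : ℤ) - (i : ℤ) + (ε i : ℤ) < 0
  · obtain ⟨i, hi⟩ := hneg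
    have hz : scaledHomog ((L.get i : ℤ) - (i : ℤ) + (ε i : ℤ)) = 0 := by
      obtain ⟨m, hm⟩ := Int.eq_negSucc_of_lt_zero hi
      rw [hm]
      rfl
    rw [List.prod_eq_zero, map_zero]
    · exact Submodule.zero_mem _
    · exact List.mem_ofFn.2 ⟨i, hz⟩
  push Not at hneg
  obtain ⟨a, ha⟩ : ∃ a : Fin L.length → ℕ, ∀ i,
      (L.get i : ℤ) - (i : ℤ) + (ε i : ℤ) = (a i : ℤ) :=
    ⟨fun i => ((L.get i : ℤ) - (i : ℤ) + (ε i : ℤ)).toNat, fun i =>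
      (Int.toNat_of_nonneg (hneg i)).symm⟩
  simp only [ha]
  have hprod : (List.ofFn fun i => scaledHomog (a i : ℤ)).prod =
      ((List.ofFn a).map fun k : ℕ => scaledHomog k).prod := by
    rw [List.map_ofFn]; rfl
  have hLsum : ∑ i, (L.get i : ℤ) = n := by
    rw [← hsum]
    conv_rhs => rw [← List.ofFn_get L, List.sum_ofFn]
    push_cast
    rfl
  have hlen : (blockLabels (List.ofFn a)).length = n := by
    rw [length_blockLabels, List.sum_ofFn]
    have h : ∑ i, (a i : ℤ) = n := by
      simp only [← ha, Finset.sum_add_distrib, Finset.sum_sub_distrib, hLsum,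
        Equiv.sum_comp ε fun k : Fin L.length => ((k : ℕ) : ℤ)]
      ring
    exact_mod_cast h
  obtain ⟨f', hf'⟩ := exists_ofFn hlen
  rw [hprod, prod_scaledHomog, hf', map_smul, placeAct_labelSeries,
    ← homog_eq_labelSeries (ker (f' ∘ π.readingPerm.symm)) _
      (fun i j => (ker_part_eq_iff _ _ _).symm)]
  refine Submodule.smul_mem _ _ (Submodule.subset_span ⟨_, ?_, rfl⟩)
  rw [Set.mem_ofPred_eq, hsq, sqSum_eq _ hf' π.readingPerm
    (fun i j => by rw [ker_part_eq_iff]; simp)]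
  have hanti : StrictAnti fun i : Fin L.length => (L.get i : ℤ) - (i : ℤ) := by
    intro i j hij
    have h1 : L.get i ≥ L.get j := List.pairwise_iff_get.1 hsorted i j hij
    have h2 : (i : ℕ) < j := hij
    show (L.get j : ℤ) - (j : ℤ) < (L.get i : ℤ) - (i : ℤ)
    omega
  have hmain := sum_sq_lt_of_strictAnti hanti (Finset.mem_erase.1 hε).1
  simp only [ha, sub_add_cancel] at hmain
  have h1 : (L.map fun a => a * a).sum = ∑ i : Fin L.length, L.get i * L.get i := by
    conv_lhs => rw [← List.ofFn_get L, List.map_ofFn, List.sum_ofFn]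
    rfl
  rw [h1, List.map_ofFn, List.sum_ofFn]
  exact_mod_cast hmain

end NCSeries

/-! ### Letting the variables commute -/

namespace NCSeries

open SetPartition

/-- The words in the letters of the monomial `x^d`. -/
noncomputable def words (d : ℕ →₀ ℕ) : Finset (List ℕ) :=
  (Finsupp.toMultiset d).toList.permutations.toFinset

theorem rho_apply (f : NCSeries) (d : ℕ →₀ ℕ) :
    rho f d = ∑ w ∈ words d, f w := rfl

theorem mem_words {d : ℕ →₀ ℕ} {w : List ℕ} :
    w ∈ words d ↔ Multiset.toFinsupp (w : Multiset ℕ) = d := by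
  rw [words, List.mem_toFinset, List.mem_permutations, ← Multiset.coe_eq_coe, Multiset.coe_toList]
  constructor
  · intro h; rw [h]; simp
  · rintro rfl; simp

theorem length_of_mem_words {d : ℕ →₀ ℕ} {w : List ℕ}
    (h : w ∈ words d) : w.length = d.degree := by
  rw [mem_words] at h
  have hc : (Finsupp.toMultiset d).card = d.degree := Finsupp.card_toMultiset d
  rw [← hc, ← h]
  simp

theorem rho_one : rho 1 = 1 := by
  ext d
  show rho 1 d = _
  rw [rho_apply, MvPowerSeries.coeff_one]
  simp only [one_apply]
  rw [Finset.sum_ite_eq']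
  congr 1
  rw [mem_words]
  simp [eq_comm]

theorem rho_mul (f g : NCSeries) : rho (f * g) = rho f * rho g := by
  ext d
  rw [MvPowerSeries.coeff_mul]
  show rho (f * g) d = ∑ p ∈ Finset.HasAntidiagonal.antidiagonal d, rho f p.1 * rho g p.2
  have hr : ∀ p : (ℕ →₀ ℕ) × (ℕ →₀ ℕ), rho f p.1 * rho g p.2 =
      ∑ x ∈ words p.1 ×ˢ words p.2, f x.1 * g x.2 := fun p =>
    (Finset.sum_mul_sum _ _ _ _).trans
      (Finset.sum_product (words p.1) (words p.2) fun x => f x.1 * g x.2).symm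
  have hl : rho (f * g) d =
      ∑ w ∈ words d, ∑ i ∈ Finset.range (w.length + 1), f (w.take i) * g (w.drop i) := rfl
  rw [Finset.sum_congr rfl fun p _ => hr p, hl, Finset.sum_sigma', Finset.sum_sigma']
  symm
  -- A pair of words corresponds to its concatenation together with the place of the cut.
  refine Finset.sum_bij' (fun x _ => ⟨x.2.1 ++ x.2.2, x.2.1.length⟩)
    (fun y _ => ⟨(Multiset.toFinsupp (y.1.take y.2 : Multiset ℕ),
      Multiset.toFinsupp (y.1.drop y.2 : Multiset ℕ)), (y.1.take y.2, y.1.drop y.2)⟩) ?_ ?_ ?_ ?_ ?_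
  · rintro ⟨⟨d1, d2⟩, u, v⟩ h
    simp only [Finset.mem_sigma, Finset.HasAntidiagonal.mem_antidiagonal,
      Finset.mem_product, mem_words] at h
    obtain ⟨h, rfl, rfl⟩ := h
    simp only [Finset.mem_sigma, mem_words, Finset.mem_range, List.length_append]
    refine ⟨?_, by omega⟩
    rw [← h, ← Multiset.coe_add, map_add]
  · rintro ⟨w, i⟩ h
    simp only [Finset.mem_sigma, mem_words] at h
    simp only [Finset.mem_sigma, Finset.HasAntidiagonal.mem_antidiagonal,
      Finset.mem_product, mem_words, and_self,
      and_true]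
    rw [← map_add, Multiset.coe_add, List.take_append_drop, h.1]
  · rintro ⟨⟨d1, d2⟩, u, v⟩ h
    simp only [Finset.mem_sigma, Finset.HasAntidiagonal.mem_antidiagonal,
      Finset.mem_product, mem_words] at h
    obtain ⟨h, rfl, rfl⟩ := h
    simp
  · rintro ⟨w, i⟩ h
    simp only [Finset.mem_sigma, Finset.mem_range] at h
    simp only [List.take_append_drop, List.length_take]
    congr 1
    omega
  · rintro ⟨⟨d1, d2⟩, u, v⟩ h
    simp

/-- Letting the variables commute is a ring homomorphism. -/
noncomputable def rhoHom : NCSeries →+* MvPowerSeries ℕ ℚ where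
  toFun := rho
  map_one' := rho_one
  map_mul' := rho_mul
  map_zero' := map_zero rho
  map_add' := map_add rho

theorem rho_placeAct {n : ℕ} (δ : Perm (Fin n)) (f : NCSeries) : rho (placeAct δ f) = rho f := by
  ext d
  show rho (placeAct δ f) d = rho f d
  rw [rho_apply, rho_apply]
  by_cases hd : d.degree = n
  · have key : ∀ (δ : Perm (Fin n)) (u : Fin n → ℕ),
        List.ofFn u ∈ words d →
        List.ofFn (u ∘ δ) ∈ words d := by
      intro δ u hu
      rw [mem_words] at hu ⊢
      rw [← hu, Multiset.coe_eq_coe.2 (Equiv.Perm.ofFn_comp_perm δ u)]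
    have hlen : ∀ w ∈ words d, w.length = n :=
      fun w hw => (length_of_mem_words hw).trans hd
    refine Finset.sum_bij'
      (fun w hw => List.ofFn ((fun i : Fin n => w.get (i.cast (hlen w hw).symm)) ∘ δ))
      (fun w hw => List.ofFn ((fun i : Fin n => w.get (i.cast (hlen w hw).symm)) ∘ δ.symm))
      ?_ ?_ ?_ ?_ ?_
    all_goals
      intro w hw
      obtain ⟨u, rfl⟩ := exists_ofFn (hlen w hw)
    · simpa using key δ u hw
    · simpa using key δ.symm u hw
    · simp [Function.comp_def]
    · simp [Function.comp_def]
    · rw [placeAct_ofFn]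
      congr 2
      funext i
      simp
  · refine Finset.sum_congr rfl fun w hw => placeAct_of_length_ne _ _ ?_
    rw [length_of_mem_words hw]
    exact hd

/-- Two words that are rearrangements of each other differ by a permutation of the places: both sort
to the same word. -/
theorem exists_comp_perm_eq {α : Type*} [LinearOrder α] {n : ℕ} {u v : Fin n → α}
    (h : (List.ofFn v).Perm (List.ofFn u)) : ∃ g : Perm (Fin n), u ∘ g = v := by
  have hsort : v ∘ Tuple.sort v = u ∘ Tuple.sort u := by
    apply List.ofFn_injective
    apply List.Perm.eq_of_pairwise' (r := (· ≤ ·))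
    · exact List.pairwise_ofFn.2 fun i j hij => Tuple.monotone_sort v hij.le
    · exact List.pairwise_ofFn.2 fun i j hij => Tuple.monotone_sort u hij.le
    · exact (Equiv.Perm.ofFn_comp_perm _ v).trans (h.trans (Equiv.Perm.ofFn_comp_perm _ u).symm)
  refine ⟨(Tuple.sort v).symm.trans (Tuple.sort u), ?_⟩
  rw [Equiv.coe_trans, ← Function.comp_assoc, ← hsort, Function.comp_assoc]
  simp

/-- Orbit-stabilizer count: the permutations of the places of a word that preserve it, summed over
all rearrangements of that word, number `n!`. -/
theorem sum_symCount_words (d : ℕ →₀ ℕ) :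
    ∑ w ∈ words d, symCount w =
      d.degree.factorial := by
  obtain ⟨u, hu⟩ : ∃ u : Fin d.degree → ℕ, (Finsupp.toMultiset d).toList = List.ofFn u :=
    exists_ofFn (by rw [Multiset.length_toList]; exact Finsupp.card_toMultiset d)
  have hmaps : ∀ g ∈ (Finset.univ : Finset (Perm (Fin d.degree))),
      List.ofFn (u ∘ g) ∈ words d := by
    intro g _
    rw [words, List.mem_toFinset, List.mem_permutations, hu]
    exact Equiv.Perm.ofFn_comp_perm g u
  have hcard := Finset.card_eq_sum_card_fiberwise hmaps
  rw [Finset.card_univ, Fintype.card_perm, Fintype.card_fin] at hcard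
  rw [hcard]
  refine Finset.sum_congr rfl fun w hw => ?_
  obtain ⟨v, rfl⟩ := exists_ofFn (length_of_mem_words hw)
  rw [words, List.mem_toFinset, List.mem_permutations, hu] at hw
  obtain ⟨g, rfl⟩ : ∃ g : Perm (Fin d.degree), u ∘ g = v :=
    exists_comp_perm_eq hw
  rw [symCount_ofFn, Fintype.card_subtype]
  refine Finset.card_equiv (Equiv.mulLeft g) fun e => ?_
  simp only [Finset.mem_filter, Finset.mem_univ, true_and, Equiv.coe_mulLeft,
    List.ofFn_injective.eq_iff, Perm.coe_mul, Function.comp_assoc]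

theorem rho_scaledHomog (k : ℤ) : rho (scaledHomog k) = SymFun.homog k := by
  ext d
  show rho (scaledHomog k) d = if (d.degree : ℤ) = k then 1 else 0
  rw [rho_apply]
  cases k with
  | negSucc k =>
    rw [if_neg (by omega)]
    exact Finset.sum_eq_zero fun w _ => rfl
  | ofNat k =>
    simp only [Int.ofNat_eq_natCast, Nat.cast_inj]
    have h : ∀ w ∈ words d, scaledHomog (k : ℤ) w =
        if d.degree = k then (k.factorial : ℚ)⁻¹ * symCount w else 0 := by
      intro w hw
      rw [scaledHomog_natCast_apply, length_of_mem_words hw]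
    rw [Finset.sum_congr rfl h]
    split_ifs with hd
    · rw [← Finset.mul_sum, ← Nat.cast_sum, sum_symCount_words, hd]
      exact inv_mul_cancel₀ (by exact_mod_cast k.factorial_ne_zero)
    · simp

theorem rho_ncdet {ℓ : ℕ} (A : Matrix (Fin ℓ) (Fin ℓ) NCSeries) :
    rho (ncdet A) = (A.map rho).det := by
  show rhoHom (ncdet A) = _
  rw [← Matrix.det_transpose, Matrix.det_apply, ncdet, map_sum]
  refine Finset.sum_congr rfl fun ε _ => ?_
  rw [map_zsmul, map_list_prod, List.map_ofFn, List.prod_ofFn]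
  rfl

theorem rho_schur {n : ℕ} (π : SetPartition n) : rho (schur π) = SymFun.schur π.shape := by
  rw [schur, rho_placeAct, sourceSchur, rho_ncdet, SymFun.schur]
  congr 1
  refine Matrix.ext fun i j => ?_
  exact rho_scaledHomog _

end NCSeries

/-! ### Linear independence of the series `h_π` -/

namespace SetPartition

/-- A permutation that cycles each block of `τ` preserves the blocks of `π` exactly when
`τ ≤ π`. -/
theorem exists_perm_forall_part_eq_iff {n : ℕ} (τ : SetPartition n) :
    ∃ g : Perm (Fin n), ∀ π : SetPartition n, π.part ∘ g = π.part ↔ τ ≤ π := by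
  choose c hc _ using fun B : Finset (Fin n) => B.exists_cycleOn
  have hmaps : ∀ i, c (τ.part i) i ∈ τ.part i := fun i =>
    (hc (τ.part i)).1.mapsTo (τ.mem_part (Finset.mem_univ i))
  have hpart : ∀ i, τ.part (c (τ.part i) i) = τ.part i := fun i =>
    τ.part_eq_of_mem (by simp) (hmaps i)
  have hinj : Function.Injective fun i => c (τ.part i) i := by
    intro i j hij
    have h : τ.part i = τ.part j := by
      rw [← hpart i, ← hpart j]
      exact congrArg τ.part hij
    have hij' : c (τ.part i) i = c (τ.part j) j := hij
    rw [h] at hij'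
    exact (c (τ.part j)).injective hij'
  refine ⟨Equiv.ofBijective _ (Finite.injective_iff_bijective.1 hinj), fun π => ?_⟩
  constructor
  · intro h
    have hstep : ∀ i, π.part (c (τ.part i) i) = π.part i := fun i => congrFun h i
    intro B hB
    obtain ⟨i, hi⟩ := τ.nonempty_of_mem_parts hB
    refine ⟨π.part i, by simp, fun j hj => ?_⟩
    obtain ⟨m, -, rfl⟩ := (hc B).exists_pow_eq hi hj
    have hpow : ∀ m : ℕ, (c B ^ m) i ∈ B ∧ π.part ((c B ^ m) i) = π.part i := by
      intro m
      induction m with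
      | zero => exact ⟨hi, rfl⟩
      | succ m ih =>
        rw [pow_succ', Perm.mul_apply]
        refine ⟨(hc B).1.mapsTo ih.1, ?_⟩
        have := hstep ((c B ^ m) i)
        rw [τ.part_eq_of_mem hB ih.1] at this
        rw [this, ih.2]
    exact (π.mem_part_iff_part_eq_part (Finset.mem_univ _) (Finset.mem_univ _)).2 (hpow m).2
  · intro h
    funext i
    obtain ⟨C, hC, hle⟩ := h (τ.part_mem.2 (Finset.mem_univ i))
    show π.part (c (τ.part i) i) = π.part i
    rw [π.part_eq_of_mem hC (hle (hmaps i)),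
      π.part_eq_of_mem hC (hle (τ.mem_part (Finset.mem_univ i)))]

/-- The matrix `λ(σ ∧ π)!` is the Gram matrix of the indicator functions of Young subgroups. -/
theorem shapeFactorial_inf {n : ℕ} (σ π : SetPartition n) :
    (σ ⊓ π).shapeFactorial = (Finset.univ.filter fun g : Perm (Fin n) =>
      σ.part ∘ g = σ.part ∧ π.part ∘ g = π.part).card := by
  rw [shapeFactorial_eq, symCount_ofFn, Fintype.card_subtype]
  congr 1
  ext g
  simp only [Finset.mem_filter, Finset.mem_univ, true_and, funext_iff, Function.comp_apply,
    part_inf_eq_iff, forall_and]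

end SetPartition

namespace NCSeries

open SetPartition

/-- A relation `∑ v_π h_π = 0` puts `v` in the kernel of a Gram matrix, so that the corresponding
combination `F` of indicator functions of Young subgroups has norm zero and vanishes. -/
theorem linearIndependent_homog (n : ℕ) :
    LinearIndependent ℚ (homog : SetPartition n → NCSeries) := by
  classical
  rw [Fintype.linearIndependent_iff]
  intro v hv
  -- The coefficient of `∑ v_π h_π` at a word whose equal letters lie in the blocks of `σ`.
  have hcoef : ∀ σ : SetPartition n, ∑ π, v π * ((σ ⊓ π).shapeFactorial : ℚ) = 0 := by
    intro σ
    obtain ⟨e⟩ : Nonempty (Finset (Fin n) ↪ ℕ) :=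
      ⟨(Fintype.equivFin _).toEmbedding.trans Fin.valEmbedding⟩
    have hker : ker (fun i => e (σ.part i)) = σ :=
      ext_part fun i j => by rw [ker_part_eq_iff, e.injective.eq_iff]
    have h := congrArg (fun f : NCSeries => f (List.ofFn fun i => e (σ.part i))) hv
    simp only [sum_apply, smul_apply, homog, mono_ofFn, hker, zero_apply, mul_ite, mul_one,
      mul_zero, Finset.sum_ite_eq, Finset.mem_univ, if_true] at h
    exact h
  -- The value at `g` of the combination of indicator functions of Young subgroups.
  set F : Perm (Fin n) → ℚ := fun g => ∑ π : SetPartition n, if π.part ∘ g = π.part then v π else 0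
    with hF
  have hsq : ∑ g, F g * F g = 0 := by
    have hgram : ∑ g, F g * F g =
        ∑ σ : SetPartition n, v σ * ∑ π, v π * ((σ ⊓ π).shapeFactorial : ℚ) := by
      simp only [hF, Finset.mul_sum]
      rw [Finset.sum_comm]
      refine Finset.sum_congr rfl fun σ _ => ?_
      simp only [Finset.sum_mul]
      rw [Finset.sum_comm]
      refine Finset.sum_congr rfl fun π _ => ?_
      rw [shapeFactorial_inf, Finset.card_filter]
      push_cast
      rw [Finset.mul_sum, Finset.mul_sum]
      refine Finset.sum_congr rfl fun g _ => ?_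
      by_cases h1 : σ.part ∘ g = σ.part <;> by_cases h2 : π.part ∘ g = π.part <;>
        simp [h1, h2, mul_comm]
    rw [hgram]
    simp [hcoef]
  have hzero : ∀ g, F g = 0 := by
    intro g
    have := (Finset.sum_eq_zero_iff_of_nonneg fun g _ => mul_self_nonneg (F g)).1 hsq g
      (Finset.mem_univ g)
    exact mul_self_eq_zero.1 this
  -- At a permutation that cycles each block of `τ`, `F` is the sum of the `v π` over `π ≥ τ`; so
  -- `v τ = 0` follows by induction from the top.
  intro τ
  induction τ using WellFoundedGT.induction with
  | ind τ ih =>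
    obtain ⟨g, hg⟩ := τ.exists_perm_forall_part_eq_iff
    have h := hzero g
    rw [hF] at h
    simp only [hg] at h
    rw [Finset.sum_eq_single τ] at h
    · simpa using h
    · intro π _ hπ
      split_ifs with hle
      · exact ih π (lt_of_le_of_ne hle (Ne.symm hπ))
      · rfl
    · simp

/-! ### Bases -/

theorem homog_mem {n : ℕ} (π : SetPartition n) : homog π ∈ NCSymDeg n :=
  Submodule.sum_mem _ fun σ _ => Submodule.smul_mem _ _ (Submodule.subset_span ⟨σ, rfl⟩)

theorem finrank_NCSymDeg_le (n : ℕ) :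
    Module.finrank ℚ (NCSymDeg n) ≤ Fintype.card (SetPartition n) :=
  finrank_range_le_card _

theorem span_homog (n : ℕ) : Submodule.span ℚ (Set.range (homog (n := n))) = NCSymDeg n := by
  have : FiniteDimensional ℚ (NCSymDeg n) :=
    FiniteDimensional.span_of_finite _ (Set.finite_range _)
  refine Submodule.eq_of_le_of_finrank_le (Submodule.span_le.2 ?_) ?_
  · rintro _ ⟨π, rfl⟩
    exact homog_mem π
  · rw [finrank_span_eq_card (linearIndependent_homog n)]
    exact finrank_NCSymDeg_le n

theorem finrank_NCSymDeg (n : ℕ) :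
    Module.finrank ℚ (NCSymDeg n) = Fintype.card (SetPartition n) := by
  rw [← span_homog, finrank_span_eq_card (linearIndependent_homog n)]

/-- The triangular expansion is inverted by induction from the largest sum of squares downwards. -/
theorem homog_mem_span_schur {n : ℕ} (π : SetPartition n) :
    homog π ∈ Submodule.span ℚ (Set.range (schur (n := n))) := by
  induction hm : n * n - π.sqSum using Nat.strong_induction_on generalizing π with
  | _ m ih =>
    obtain ⟨c, hc, h⟩ := schur_sub_mem_span π
    have hle : Submodule.span ℚ (homog '' {τ : SetPartition n | π.sqSum < τ.sqSum}) ≤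
        Submodule.span ℚ (Set.range (schur (n := n))) := by
      refine Submodule.span_le.2 ?_
      rintro _ ⟨τ, hτ, rfl⟩
      have h1 : π.sqSum < τ.sqSum := hτ
      have h2 := τ.sqSum_le
      exact ih _ (by omega) τ rfl
    have h3 := Submodule.sub_mem _ (Submodule.subset_span (Set.mem_range_self π)) (hle h)
    rw [sub_sub_cancel] at h3
    exact (Submodule.smul_mem_iff _ hc).1 h3

theorem schur_mem {n : ℕ} (π : SetPartition n) : schur π ∈ NCSymDeg n := by
  obtain ⟨c, -, h⟩ := schur_sub_mem_span π
  have hle : Submodule.span ℚ (homog '' {τ : SetPartition n | π.sqSum < τ.sqSum}) ≤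
      NCSymDeg n := by
    refine Submodule.span_le.2 ?_
    rintro _ ⟨τ, -, rfl⟩
    exact homog_mem τ
  have := Submodule.add_mem _ (hle h) (Submodule.smul_mem _ c (homog_mem π))
  rwa [sub_add_cancel] at this

theorem span_schur (n : ℕ) : Submodule.span ℚ (Set.range (schur (n := n))) = NCSymDeg n := by
  apply le_antisymm
  · refine Submodule.span_le.2 ?_
    rintro _ ⟨π, rfl⟩
    exact schur_mem π
  · rw [← span_homog]
    refine Submodule.span_le.2 ?_
    rintro _ ⟨π, rfl⟩
    exact homog_mem_span_schur π

theorem linearIndependent_schur (n : ℕ) :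
    LinearIndependent ℚ (schur : SetPartition n → NCSeries) := by
  rw [linearIndependent_iff_card_eq_finrank_span, Set.finrank, span_schur, finrank_NCSymDeg]

theorem apply_eq_zero_of_mem {n : ℕ} {f : NCSeries} (hf : f ∈ NCSymDeg n) {w : List ℕ}
    (hw : w.length ≠ n) : f w = 0 := by
  induction hf using Submodule.span_induction with
  | mem x hx =>
    obtain ⟨π, rfl⟩ := hx
    exact mono_of_length_ne π hw
  | zero => rfl
  | add x y _ _ hx hy => rw [add_apply, hx, hy, add_zero]
  | smul a x _ hx => rw [smul_apply, hx, mul_zero]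

theorem apply_eq_zero_of_mem_iSup {ι : Sort*} {p : ι → Submodule ℚ NCSeries} {w : List ℕ}
    (hp : ∀ i, ∀ f ∈ p i, f w = 0) {f : NCSeries} (hf : f ∈ ⨆ i, p i) : f w = 0 := by
  induction hf using Submodule.iSup_induction' with
  | mem i x hx => exact hp i x hx
  | zero => rfl
  | add x y _ _ hx hy => rw [add_apply, hx, hy, add_zero]

theorem linearIndependent_schur_sigma :
    LinearIndependent ℚ fun p : Σ n : ℕ+, SetPartition n => schur p.2 := by
  refine linearIndependent_iUnion_finite (f := fun (n : ℕ+) (π : SetPartition n) => schur π)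
    (fun n => linearIndependent_schur n) fun i t _ hi => ?_
  simp only [span_schur]
  rw [Submodule.disjoint_def]
  intro f hf hft
  funext w
  by_cases hw : w.length = i
  · refine apply_eq_zero_of_mem_iSup (fun j g hg => ?_) hft
    refine apply_eq_zero_of_mem_iSup (p := fun _ : j ∈ t => NCSymDeg j) (fun hj g hg => ?_) hg
    refine apply_eq_zero_of_mem hg fun h => hi ?_
    rwa [PNat.coe_injective (hw.symm.trans h)]
  · exact apply_eq_zero_of_mem hf hw

theorem span_schur_sigma :
    Submodule.span ℚ (Set.range fun p : Σ n : ℕ+, SetPartition n => schur p.2) = NCSymPos := by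
  rw [Set.range_sigma_eq_iUnion_range, Submodule.span_iUnion, NCSymPos]
  exact iSup_congr fun n => span_schur n

theorem NCSymDeg_zero : NCSymDeg 0 = Submodule.span ℚ {(1 : NCSeries)} := by
  have h : ∀ π : SetPartition 0, mono π = 1 := by
    intro π
    funext w
    cases w with
    | nil => exact if_pos ⟨Fin.elim0, rfl, fun j => j.elim0⟩
    | cons a w => exact mono_of_length_ne π (by simp)
  rw [NCSymDeg]
  congr 1
  ext f
  simp only [Set.mem_range, h, exists_const, Set.mem_singleton_iff, eq_comm]

theorem NCSym_eq_sup : NCSym = Submodule.span ℚ {(1 : NCSeries)} ⊔ NCSymPos := by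
  rw [← NCSymDeg_zero, NCSym, NCSymPos]
  apply le_antisymm
  · refine iSup_le fun n => ?_
    rcases Nat.eq_zero_or_pos n with rfl | hn
    · exact le_sup_left
    · exact le_sup_of_le_right (le_iSup (fun n : ℕ+ => NCSymDeg n) ⟨n, hn⟩)
  · exact sup_le (le_iSup NCSymDeg 0) (iSup_le fun n => le_iSup NCSymDeg n)

theorem one_not_mem_NCSymPos : (1 : NCSeries) ∉ NCSymPos := by
  intro h
  have h0 : (1 : NCSeries) [] = 0 := apply_eq_zero_of_mem_iSup
    (fun (n : ℕ+) f hf => apply_eq_zero_of_mem hf (by simpa using n.ne_zero.symm)) h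
  simp [one_apply] at h0

end NCSeries

/-- A linearly independent family is a basis of any subspace that it spans. -/
theorem exists_basis_of_span_eq {ι K M : Type*} [Field K] [AddCommGroup M] [Module K M] {v : ι → M}
    (hv : LinearIndependent K v) {S : Submodule K M} (hS : Submodule.span K (Set.range v) = S) :
    ∃ b : Module.Basis ι K S, ∀ i, (b i : M) = v i := by
  subst hS
  exact ⟨Module.Basis.span hv, fun i => congrArg Subtype.val (Module.Basis.span_apply hv i)⟩

open NCSeries in
theorem theorem4p3 :
    -- `{s_π : π ⊢ [n], n ≥ 1}` is a basis of `NCSym^1 ⊕ NCSym^2 ⊕ ⋯`,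
    (∃ b : Module.Basis (Σ n : ℕ+, SetPartition n) ℚ NCSymPos,
      ∀ p, (b p : NCSeries) = NCSeries.schur p.2) ∧
    -- and together with `1`, which spans `NCSym^0`, it is a basis of `NCSym`;
    (∃ b : Module.Basis (Option (Σ n : ℕ+, SetPartition n)) ℚ NCSym,
      (b none : NCSeries) = 1 ∧ ∀ p, (b (some p) : NCSeries) = NCSeries.schur p.2) ∧
    -- the part of degree `n` is a basis of `NCSym^n`;
    (∀ n : ℕ+, ∃ b : Module.Basis (SetPartition n) ℚ (NCSymDeg n),
      ∀ π, (b π : NCSeries) = NCSeries.schur π) ∧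
    -- `ρ (s_π) = s_{λ(π)}`.
    (∀ (n : ℕ+) (π : SetPartition n),
      NCSeries.rho (NCSeries.schur π) = SymFun.schur π.shape) := by
  refine ⟨exists_basis_of_span_eq linearIndependent_schur_sigma span_schur_sigma, ?_,
    fun n => exists_basis_of_span_eq (linearIndependent_schur n) (span_schur n),
    fun n π => rho_schur π⟩
  have hli : LinearIndependent ℚ (fun o : Option (Σ n : ℕ+, SetPartition n) =>
      o.elim (1 : NCSeries) fun p => schur p.2) := by
    rw [linearIndependent_option]
    refine ⟨linearIndependent_schur_sigma, ?_⟩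
    show (1 : NCSeries) ∉ Submodule.span ℚ (Set.range fun p : Σ n : ℕ+, SetPartition n => schur p.2)
    rw [span_schur_sigma]
    exact one_not_mem_NCSymPos
  obtain ⟨b, hb⟩ := exists_basis_of_span_eq hli (S := NCSym) (by
    rw [NCSym_eq_sup, ← span_schur_sigma, ← Submodule.span_union]
    congr 1
    ext f
    simp [Option.exists, eq_comm])
  exact ⟨b, hb none, fun p => hb (some p)⟩
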